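/- Let $n,m,p\ge 0$ be integers, let $A_0,A_1,\dots,A_p\in\mathbb R^{n\times n}$ and $B\in\mathbb R^{n\times m}$, let $\mathcal P\subset\mathbb R^p$ be a polytope (the convex hull of finitely many points), and put $A(\rho)=A_0+\sum_{j=1}^p\rho_jA_j$. For $\rho\in\mathcal P$ let $$\mathcal K_\rho=\{K\in\mathbb R^{m\times n}:\ \text{every eigenvalue } \lambda\in\mathbb C \text{ of } A(\rho)-BK \text{ satisfies } \operatorname{Re}\lambda<0\},\qquad \mathcal K_{\mathcal P}=\bigcap_{\rho\in\mathcal P}\mathcal K_\rho .$$ Let $\mathcal C=\prod_{i=1}^{mn}[\underline C_i,\overline C_i]\subseteq\mathbb R^{mn}$ be a hyperrectangle, and let $\operatorname{vec}:\mathbb R^{m\times n}\to\mathbb R^{mn}$ be the vectorization (stacking of columns). Write $\det(sI-(A(\rho)-BK))=s^n+c_1s^{n-1}+\dots+c_n$, where $c_k=c_k(K,\rho)$, and set $c_0=1$ and $c_k=0$ for $k>n$. Define the division-free Routh table by $\tilde R_{1,j}=c_{2j-2}$, $\tilde R_{2,j}=c_{2j-1}$ and $$\tilde R_{i,j}=\tilde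 R_{i-1,1}\tilde R_{i-2,j+1}-\tilde R_{i-2,1}\tilde R_{i-1,j+1}\qquad(i\ge 3,\ j\ge 1),$$ and define the Routh–Hurwitz polynomials $f_i(K,\rho)=\tilde R_{i+1,1}$ for $1\le i\le n-1$ (so $f_1=c_1$ if $n\ge2$) and $f_n(K,\rho)=c_n$. Suppose that for every $i=1,\dots,n$ the optimization problem $$d_i=\inf\bigl\{\|K_{\mathcal C}-K_{\mathcal P}\|_F:\ K_{\mathcal P},K_{\mathcal C}\in\mathbb R^{m\times n},\ \rho\in\mathbb R^p,\ f_i(K_{\mathcal P},\rho)\le 0,\ \operatorname{vec}(K_{\mathcal C})\in\mathcal C,\ \rho\in\mathcal P\bigr\}$$ is feasible and has a strictly positive optimal value $d_i>0$. Then $\mathcal C\subseteq\operatorname{vec}(\mathcal K_{\mathcal P})$. -/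

import Mathlib

namespace LPVGain

noncomputable section

/-- A polytopic linear parameter-varying system `ẋ = A(ρ) x + B u` with `n` states, `m` inputs and
`p` parameters: `A(ρ) = A₀ + ∑ⱼ ρⱼ Aⱼ` and the parameter set `P` is a (convex, compact) polytope,
i.e. the convex hull of finitely many points. -/
structure PolytopicLPV (n m p : ℕ) where
  A₀ : Matrix (Fin n) (Fin n) ℝ
  Ac : Fin p → Matrix (Fin n) (Fin n) ℝ
  B : Matrix (Fin n) (Fin m) ℝ
  P : Set (Fin p → ℝ)
  isPolytope : ∃ V : Set (Fin p → ℝ), V.Finite ∧ P = convexHull ℝ V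

variable {n m p : ℕ}

/-- The system matrix `A(ρ)`. -/
def PolytopicLPV.A (S : PolytopicLPV n m p) (ρ : Fin p → ℝ) : Matrix (Fin n) (Fin n) ℝ :=
  S.A₀ + ∑ j, ρ j • S.Ac j

/-- The closed-loop matrix `A(ρ) - B K`. -/
def PolytopicLPV.closedLoop (S : PolytopicLPV n m p) (K : Matrix (Fin m) (Fin n) ℝ)
    (ρ : Fin p → ℝ) : Matrix (Fin n) (Fin n) ℝ :=
  S.A ρ - S.B * K

/-- All complex eigenvalues of the real matrix `M` have negative real part. -/
def IsHurwitz (M : Matrix (Fin n) (Fin n) ℝ) : Prop :=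
  ∀ z ∈ spectrum ℂ (M.map Complex.ofReal), z.re < 0

/-- The stability region `K_ρ`. -/
def PolytopicLPV.stabilityRegion (S : PolytopicLPV n m p) (ρ : Fin p → ℝ) :
    Set (Matrix (Fin m) (Fin n) ℝ) :=
  {K | IsHurwitz (S.closedLoop K ρ)}

/-- The robust stability region `K_P = ⋂_{ρ ∈ P} K_ρ`. -/
def PolytopicLPV.robustRegion (S : PolytopicLPV n m p) : Set (Matrix (Fin m) (Fin n) ℝ) :=
  ⋂ ρ ∈ S.P, S.stabilityRegion ρ

/-- The hyperrectangle `∏ᵢ [lo i, hi i]` in the space of vectorized gains. `Matrix.vec` (stacking of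
columns) takes values in `Fin n × Fin m → ℝ`. -/
def hyperrectangle (lo hi : Fin n × Fin m → ℝ) : Set (Fin n × Fin m → ℝ) :=
  Set.univ.pi fun i => Set.Icc (lo i) (hi i)

/-- The coefficient `c_k` in `det (sI - M) = sⁿ + c₁ sⁿ⁻¹ + ⋯ + cₙ` (with `c₀ = 1`); missing
coefficients (`k > n`) are zero. -/
def charCoeff (M : Matrix (Fin n) (Fin n) ℝ) (k : ℕ) : ℝ :=
  if k ≤ n then M.charpoly.coeff (n - k) else 0

/-- The division-free Routh table of the coefficient sequence `c`. Rows and columns are counted from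
zero: `routhTable c i j` is the entry `R̃_{i+1,j+1}` of the usual one-based table. -/
def routhTable (c : ℕ → ℝ) : ℕ → ℕ → ℝ
  | 0, j => c (2 * j)
  | 1, j => c (2 * j + 1)
  | i + 2, j =>
      routhTable c (i + 1) 0 * routhTable c i (j + 1) -
        routhTable c i 0 * routhTable c (i + 1) (j + 1)

/-- The Routh–Hurwitz polynomials `f₁ = c₁, f₂ = R̃_{3,1}, …, f_{n-1} = R̃_{n,1}, fₙ = cₙ` of the
closed loop; the index `i : Fin n` stands for `f_{i+1}`. -/
def PolytopicLPV.routhPoly (S : PolytopicLPV n m p) (i : Fin n) (K : Matrix (Fin m) (Fin n) ℝ)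
    (ρ : Fin p → ℝ) : ℝ :=
  if (i : ℕ) + 1 = n then charCoeff (S.closedLoop K ρ) n
  else routhTable (charCoeff (S.closedLoop K ρ)) ((i : ℕ) + 1) 0

section Frobenius

attribute [local instance] Matrix.frobeniusNormedAddCommGroup

/-- The Frobenius norm. -/
def frobNorm (M : Matrix (Fin m) (Fin n) ℝ) : ℝ := ‖M‖

end Frobenius

/-- The feasible set of the `i`-th problem: triples `(K_P, K_C, ρ)` with `fᵢ(K_P, ρ) ≤ 0`,
`vec K_C ∈ C` and `ρ ∈ P`. -/
def PolytopicLPV.feasibleSet (S : PolytopicLPV n m p) (C : Set (Fin n × Fin m → ℝ)) (i : Fin n) :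
    Set (Matrix (Fin m) (Fin n) ℝ × Matrix (Fin m) (Fin n) ℝ × (Fin p → ℝ)) :=
  {z | S.routhPoly i z.1 z.2.2 ≤ 0 ∧ z.2.1.vec ∈ C ∧ z.2.2 ∈ S.P}

/-- The optimal value `dᵢ`: the infimum of `‖K_C - K_P‖_F` over the feasible set (meaningful when
that set is nonempty; the objective is bounded below by zero). -/
def PolytopicLPV.optValue (S : PolytopicLPV n m p) (C : Set (Fin n × Fin m → ℝ)) (i : Fin n) : ℝ :=
  sInf ((fun z => frobNorm (z.2.1 - z.1)) '' S.feasibleSet C i)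

end

end LPVGain

namespace LPVGain

open Polynomial ComplexConjugate

/-! If some `f_i(K, ρ) ≤ 0` with `vec K ∈ C` and `ρ ∈ P`, then `(K, K, ρ)` is feasible at distance
zero, contradicting `d_i > 0`. So every `f_i` is positive on `C × P`, and the Routh–Hurwitz
criterion gives stability.

The criterion (`re_neg_of_routhTable_pos`) is proved by induction on the degree. Dropping the first
Routh row turns `P` into `Q` of degree `M`, one less, with `2 c₁ P(s) = (1 + w) Q(s) ± (w - 1)
Q(-s)` and `w = c₁ + c₀ s`. At a root `z` of `P` with `Re z ≥ 0`, `Re w > 0` gives `|w - 1| < |1 +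
w|`, while stability of `Q` gives `|Q(-z)| ≤ |Q(z)| ≠ 0`, so the two terms cannot cancel. -/

/-- The real polynomial `c₀ Xᴺ + c₁ Xᴺ⁻¹ + ⋯ + c_N`. -/
noncomputable def descPoly (N : ℕ) (c : ℕ → ℝ) : ℝ[X] :=
  ∑ k ∈ Finset.range (N + 1), C (c k) * X ^ (N - k)

theorem aeval_descPoly (N : ℕ) (c : ℕ → ℝ) (s : ℂ) :
    aeval s (descPoly N c) = ∑ k ∈ Finset.range (N + 1), (c k : ℂ) * s ^ (N - k) := by
  simp [descPoly, map_sum]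

/-- The coefficient sequence whose Routh table is the Routh table of `c` without its first row. -/
def routhReduce (c : ℕ → ℝ) (k : ℕ) : ℝ :=
  if Even k then c (k + 1) else c 1 * c (k + 1) - c 0 * c (k + 2)

theorem routhTable_routhReduce (c : ℕ → ℝ) (i j : ℕ) :
    routhTable (routhReduce c) i j = routhTable c (i + 1) j := by
  induction i using Nat.strong_induction_on generalizing j with
  | _ i ih =>
    match i, ih with
    | 0, _ => simp [routhTable, routhReduce]
    | 1, _ =>
      have h : ¬ Even (2 * j + 1) := by simp
      simp only [routhTable, routhReduce, if_neg h]
      ring_nf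
    | i + 2, ih =>
      rw [routhTable, ih (i + 1) (by omega), ih (i + 1) (by omega), ih i (by omega),
        ih i (by omega)]
      rfl

/-- For a real polynomial with all roots in the open left half-plane, reflecting a point of the
closed right half-plane in the origin does not increase the absolute value. -/
theorem norm_aeval_neg_le {q : ℝ[X]} (hq : ∀ z : ℂ, aeval z q = 0 → z.re < 0) {s : ℂ}
    (hs : 0 ≤ s.re) : ‖aeval (-s) q‖ ≤ ‖aeval s q‖ := by
  have hq0 : q.map (algebraMap ℝ ℂ) ≠ 0 := by
    intro h
    have h1 := hq 0 (by rw [aeval_def, ← eval_map, h, eval_zero])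
    simp at h1
  have key (z : ℂ) : ‖aeval z q‖ = ‖(q.map (algebraMap ℝ ℂ)).leadingCoeff‖ *
      ((q.map (algebraMap ℝ ℂ)).roots.map fun a => ‖z - a‖).prod := by
    have h := (IsAlgClosed.splits (q.map (algebraMap ℝ ℂ))).eval_eq_prod_roots z
    rw [aeval_def, ← eval_map, h, norm_mul]
    congr 1
    exact (map_multiset_prod (normHom : ℂ →*₀ ℝ) _).trans (by simp [Multiset.map_map])
  -- Real coefficients allow `-s` to be replaced by `-conj s`, the mirror image of `s` in the
  -- imaginary axis. It has the same imaginary part as `s`, so each factor `|s - a|` can be compared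
  -- separately.
  have hconj : ‖aeval (-s) q‖ = ‖aeval (-conj s) q‖ := by
    rw [← map_neg, aeval_conj, RCLike.norm_conj]
  rw [hconj, key, key]
  refine mul_le_mul_of_nonneg_left ?_ (norm_nonneg _)
  refine Multiset.prod_map_le_prod_map₀ _ _ (fun _ _ => norm_nonneg _) fun a ha => ?_
  have hre : a.re < 0 := hq a (by
    rw [aeval_def, ← eval_map]
    exact (mem_roots hq0).1 ha)
  rw [← sq_le_sq₀ (norm_nonneg _) (norm_nonneg _), ← Complex.normSq_eq_norm_sq,
    ← Complex.normSq_eq_norm_sq, Complex.normSq_apply, Complex.normSq_apply]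
  simp only [Complex.sub_re, Complex.sub_im, Complex.neg_re, Complex.neg_im, Complex.conj_re,
    Complex.conj_im]
  nlinarith [mul_nonneg hs (neg_nonneg.2 hre.le)]

/-- One step of the Routh scheme, read backwards. -/
theorem aeval_descPoly_succ (M : ℕ) (c : ℕ → ℝ) (hc : c (M + 2) = 0) (s : ℂ) :
    2 * (c 1 : ℂ) * aeval s (descPoly (M + 1) c) =
      (1 + (c 1 + c 0 * s)) * aeval s (descPoly M (routhReduce c)) +
        ((c 1 + c 0 * s) - 1) * ((-1) ^ M * aeval (-s) (descPoly M (routhReduce c))) := by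
  -- `s` times the even-indexed part of the reduced polynomial. Its terms cancel the products `c 0 *
  -- c (k + 2)` in the odd-indexed part, leaving a telescoping sum whose end term vanishes by `hc`.
  set e : ℕ → ℂ := fun k => if Even k then (c (k + 1) : ℂ) * s ^ (M + 1 - k) else 0 with he
  have htel : ∑ k ∈ Finset.range (M + 1), (e k - e (k + 1)) = c 1 * s ^ (M + 1) := by
    rw [Finset.sum_range_sub']
    simp [he, hc]
  have hterm : ∀ k ∈ Finset.range (M + 1),
      (1 + ((c 1 : ℂ) + c 0 * s)) * (routhReduce c k * s ^ (M - k)) +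
        ((c 1 + c 0 * s) - 1) * ((-1) ^ M * (routhReduce c k * (-s) ^ (M - k))) =
      2 * c 1 * (c (k + 1) * s ^ (M - k)) + 2 * c 0 * (e k - e (k + 1)) := by
    intro k hk
    obtain ⟨d, rfl⟩ := Nat.exists_eq_add_of_le (Nat.lt_succ_iff.1 (Finset.mem_range.1 hk))
    have h1 : k + d - k = d := by omega
    have h2 : k + d + 1 - k = d + 1 := by omega
    have h3 : k + d + 1 - (k + 1) = d := by omega
    have hd : (-1 : ℂ) ^ d * (-1) ^ d = 1 := by rw [← mul_pow]; simp
    rw [neg_pow s, pow_add (-1 : ℂ) k d, h1]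
    rcases Nat.even_or_odd k with hk | hk
    · have hk' : ¬ Even (k + 1) := by simpa [Nat.even_add_one] using hk
      simp only [he, routhReduce, if_pos hk, if_neg hk', hk.neg_one_pow, h2]
      linear_combination (c 1 + c 0 * s - 1) * c (k + 1) * s ^ d * hd
    · have hk' : Even (k + 1) := hk.add_one
      have hk2 : ¬ Even k := Nat.not_even_iff_odd.2 hk
      simp only [he, routhReduce, if_pos hk', if_neg hk2, hk.neg_one_pow, h3]
      push_cast
      linear_combination -(c 1 + c 0 * s - 1) * (c 1 * c (k + 1) - c 0 * c (k + 2)) * s ^ d * hd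
  simp only [aeval_descPoly, Finset.mul_sum]
  rw [← Finset.sum_add_distrib, Finset.sum_congr rfl hterm, Finset.sum_add_distrib,
    ← Finset.mul_sum, ← Finset.mul_sum, ← Finset.mul_sum, htel, Finset.sum_range_succ']
  simp only [Nat.add_sub_add_right, Nat.sub_zero]
  ring

/-- Sufficiency in the Routh–Hurwitz criterion, for the division-free Routh table. -/
theorem re_neg_of_routhTable_pos (N : ℕ) (c : ℕ → ℝ) (hc : ∀ k, N < k → c k = 0)
    (hpos : ∀ i < N, 0 < routhTable c i 0) (hlast : 0 < c N) (z : ℂ)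
    (hz : aeval z (descPoly N c) = 0) : z.re < 0 := by
  induction N generalizing c z with
  | zero =>
    simp [aeval_descPoly] at hz
    exact absurd hz hlast.ne'
  | succ M ih =>
    have h0 : 0 < c 0 := by simpa [routhTable] using hpos 0 (by omega)
    have h1 : 0 < c 1 := by
      rcases Nat.eq_zero_or_pos M with rfl | hM
      · exact hlast
      · simpa [routhTable] using hpos 1 (by omega)
    have hq : ∀ w : ℂ, aeval w (descPoly M (routhReduce c)) = 0 → w.re < 0 := by
      refine ih (routhReduce c) (fun k hk => ?_) (fun i hi => ?_) ?_
      · simp [routhReduce, hc (k + 1) (by omega), hc (k + 2) (by omega)]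
      · rw [routhTable_routhReduce]
        exact hpos _ (by omega)
      -- The last coefficient becomes `c (M + 1)` or `c 1 * c (M + 1)`, according to parity. Its
      -- sign therefore survives each reduction, and `cₙ` can stand in for the last Routh entry.
      · rw [routhReduce, hc (M + 2) (by omega)]
        split_ifs
        · exact hlast
        · simpa using mul_pos h1 hlast
    by_contra! hre
    have hstep := aeval_descPoly_succ M c (hc _ (by omega)) z
    rw [hz, mul_zero] at hstep
    set w : ℂ := c 1 + c 0 * z with hw
    set Q := descPoly M (routhReduce c)
    have hwre : 0 < w.re := by
      simp only [hw, Complex.add_re, Complex.ofReal_re, Complex.re_ofReal_mul]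
      positivity
    have hQ : 0 < ‖aeval z Q‖ := norm_pos_iff.2 fun h => (hq z h).not_ge hre
    have hlt : ‖w - 1‖ < ‖1 + w‖ := by
      rw [← sq_lt_sq₀ (norm_nonneg _) (norm_nonneg _), ← Complex.normSq_eq_norm_sq,
        ← Complex.normSq_eq_norm_sq, Complex.normSq_apply, Complex.normSq_apply]
      simp
      nlinarith
    have hnorm : ‖1 + w‖ * ‖aeval z Q‖ = ‖w - 1‖ * ‖aeval (-z) Q‖ := by
      have := congrArg norm (eq_neg_of_add_eq_zero_left hstep.symm)
      simpa using this
    have hle := mul_le_mul_of_nonneg_left (norm_aeval_neg_le hq hre) (norm_nonneg (w - 1))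
    have := mul_lt_mul_of_pos_right hlt hQ
    linarith

theorem descPoly_charCoeff {n : ℕ} (M : Matrix (Fin n) (Fin n) ℝ) :
    descPoly n (charCoeff M) = M.charpoly := by
  have hdeg : M.charpoly.natDegree = n := by simp
  conv_rhs => rw [M.charpoly.as_sum_range_C_mul_X_pow, hdeg, ← Finset.sum_range_reflect]
  refine Finset.sum_congr rfl fun k hk => ?_
  have hk' : k ≤ n := Nat.lt_succ_iff.1 (Finset.mem_range.1 hk)
  simp [charCoeff, hk']

theorem isHurwitz_of_routhTable_pos {n : ℕ} (M : Matrix (Fin n) (Fin n) ℝ)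
    (hpos : ∀ i, 0 < i → i < n → 0 < routhTable (charCoeff M) i 0)
    (hlast : 0 < charCoeff M n) : IsHurwitz M := by
  intro z hz
  have hdeg : M.charpoly.natDegree = n := by simp
  refine re_neg_of_routhTable_pos n (charCoeff M) (fun k hk => ?_) (fun i hi => ?_) hlast z ?_
  · simp [charCoeff, hk.not_ge]
  · rcases Nat.eq_zero_or_pos i with rfl | hi0
    · have h : charCoeff M 0 = 1 := by
        have := M.charpoly_monic.coeff_natDegree
        rw [hdeg] at this
        simpa [charCoeff] using this
      simp [routhTable, h]
    · exact hpos i hi0 hi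
  · rw [descPoly_charCoeff, aeval_def, ← eval_map]
    have h := Matrix.mem_spectrum_iff_isRoot_charpoly.1 hz
    change (M.map (algebraMap ℝ ℂ)).charpoly.IsRoot z at h
    rwa [Matrix.charpoly_map] at h

/-- A violation at `K` itself would give a feasible point of objective value zero; the objective is
bounded below by zero, so the infimum would be at most zero. -/
theorem PolytopicLPV.routhPoly_pos {n m p : ℕ} (S : PolytopicLPV n m p)
    {C : Set (Fin n × Fin m → ℝ)} {i : Fin n} (hpos : 0 < S.optValue C i)
    {K : Matrix (Fin m) (Fin n) ℝ} (hK : K.vec ∈ C) {ρ : Fin p → ℝ} (hρ : ρ ∈ S.P) :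
    0 < S.routhPoly i K ρ := by
  by_contra! h
  refine hpos.not_ge (csInf_le ⟨0, ?_⟩ ⟨(K, K, ρ), ⟨h, hK, hρ⟩, ?_⟩)
  · rintro _ ⟨z, -, rfl⟩
    let _ := Matrix.frobeniusNormedAddCommGroup (m := Fin m) (n := Fin n) (α := ℝ)
    exact norm_nonneg (z.2.1 - z.1)
  · let _ := Matrix.frobeniusNormedAddCommGroup (m := Fin m) (n := Fin n) (α := ℝ)
    simp [frobNorm]

end LPVGain

theorem mainTheorem9 {n m p : ℕ} (S : LPVGain.PolytopicLPV n m p) (lo hi : Fin n × Fin m → ℝ)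
    (hfeas : ∀ i : Fin n, (S.feasibleSet (LPVGain.hyperrectangle lo hi) i).Nonempty)
    (hpos : ∀ i : Fin n, 0 < S.optValue (LPVGain.hyperrectangle lo hi) i) :
    LPVGain.hyperrectangle lo hi ⊆ Matrix.vec '' S.robustRegion := by
  intro v hv
  obtain ⟨K, rfl⟩ : ∃ K : Matrix (Fin m) (Fin n) ℝ, K.vec = v := ⟨fun i j => v (j, i), rfl⟩
  refine ⟨K, Set.mem_iInter₂.2 fun ρ hρ => ?_, rfl⟩
  have hf (i : Fin n) : 0 < S.routhPoly i K ρ := S.routhPoly_pos (hpos i) hv hρ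
  refine LPVGain.isHurwitz_of_routhTable_pos _ (fun i hi0 hin => ?_) ?_
  -- The zero-based row `i` starts with `f_i`, which has index `i - 1` in `Fin n`.
  · have h := hf ⟨i - 1, by omega⟩
    have h1 : i - 1 + 1 = i := by omega
    simpa [LPVGain.PolytopicLPV.routhPoly, h1, hin.ne] using h
  -- For `n = 0` there is no `f_n`; the required coefficient is `c₀ = 1`.
  · rcases Nat.eq_zero_or_pos n with rfl | hn
    · simp [LPVGain.charCoeff]
    · have h := hf ⟨n - 1, by omega⟩
      have h1 : n - 1 + 1 = n := by omega
      simpa [LPVGain.PolytopicLPV.routhPoly, h1] using h
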